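/- Let $T>0$, and let $p,q:\mathbb R\to\mathbb R$ be $T$-periodic, with $p>0$ continuously differentiable and $q$ continuous. Consider $-(p f')'+q f=\lambda f$ with real parameter $\lambda$. For each $\lambda$, let $f_1(\cdot,\lambda)$ and $f_2(\cdot,\lambda)$ be the solutions on $\mathbb R$ with $f_1(0,\lambda)=1$, $f_1'(0,\lambda)=0$, $f_2(0,\lambda)=0$, $f_2'(0,\lambda)=1$, and let $D(\lambda)=f_1(T,\lambda)+f_2'(T,\lambda)$ be Hill's discriminant. Let $\lambda_0$ be the lowest eigenvalue of the Sturm–Liouville problem $-(p f')'+q f=\lambda f$ on $[0,T]$ with periodic boundary conditions $f(0)=f(T)$, $f'(0)=f'(T)$, and let $f_0$ be a corresponding (real, not identically zero) eigenfunction. Then $f_0$ has no zeros on $[0,T]$, and for every $\lambda\in\mathbb R$ $$D(\lambda)=\sum_{n=0}^{\infty}\left(\tilde X^{(2n)}(T)+X^{(2n)}(T)\right)(\lambda-\lambda_0)^n ,$$ where the series converges uniformly on every compact set of values of $\lambda$. Here $\tilde X^{(0)}\equiv X^{(0)}\equiv 1$ and, for $n\ge 1$, $$\tilde X^{(n)}(x)=\begin{cases}\displaystyle\int_0^x\tilde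 X^{(n-1)}(\xi)\,f_0(\xi)^2\,d\xi, & n\text{ odd},\\[2mm] \displaystyle-\int_0^x\tilde X^{(n-1)}(\xi)\,\frac{d\xi}{p(\xi)f_0(\xi)^2}, & n\text{ even},\end{cases}\qquad X^{(n)}(x)=\begin{cases}\displaystyle-\int_0^x X^{(n-1)}(\xi)\,\frac{d\xi}{p(\xi)f_0(\xi)^2}, & n\text{ odd},\\[2mm] \displaystyle\int_0^x X^{(n-1)}(\xi)\,f_0(\xi)^2\,d\xi, & n\text{ even}.\end{cases}$$ -/

import Mathlib

open Set Filter Topology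

/-- `f` solves the Sturm–Liouville equation `-(p f')' + q f = lam f` on the set `s` (an interval;
derivatives at an endpoint of `s` are one-sided). -/
structure IsHillSolutionOn (p q : ℝ → ℝ) (lam : ℝ) (s : Set ℝ) (f : ℝ → ℝ) : Prop where
  diff : DifferentiableOn ℝ f s
  diff_quasi : DifferentiableOn ℝ (fun y => p y * derivWithin f s y) s
  eqn : ∀ x ∈ s,
    -(derivWithin (fun y => p y * derivWithin f s y) s x) + q x * f x = lam * f x

/-- `f` solves `-(p f')' + q f = lam f` on the whole line with `f 0 = a` and `f' 0 = b`. -/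
def IsHillIVPSolution (p q : ℝ → ℝ) (lam a b : ℝ) (f : ℝ → ℝ) : Prop :=
  IsHillSolutionOn p q lam univ f ∧ f 0 = a ∧ deriv f 0 = b

/-- A planar linear system with continuous coefficients has a solution on `(-n, n)`. -/
theorem linearSystem_exists_Ioo (u w : ℝ → ℝ) (hu : Continuous u) (hw : Continuous w)
    (z : ℝ × ℝ) (n : ℝ) (hn : 0 < n) :
    ∃ γ : ℝ → ℝ × ℝ, γ 0 = z ∧
      ∀ t ∈ Ioo (-n) n, HasDerivAt γ (u t * (γ t).2, w t * (γ t).1) t := by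
  obtain ⟨K₁, hK₁⟩ := (isCompact_Icc (a := -n) (b := n)).exists_bound_of_continuousOn hu.continuousOn
  obtain ⟨K₂, hK₂⟩ := (isCompact_Icc (a := -n) (b := n)).exists_bound_of_continuousOn hw.continuousOn
  obtain ⟨K, hKu, hKw⟩ : ∃ K : NNReal, (∀ t ∈ Icc (-n) n, |u t| ≤ K) ∧
      ∀ t ∈ Icc (-n) n, |w t| ≤ K := by
    refine ⟨(max K₁ K₂).toNNReal, fun t ht => ?_, fun t ht => ?_⟩
    · exact ((hK₁ t ht).trans (le_max_left _ _)).trans (Real.le_coe_toNNReal _)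
    · exact ((hK₂ t ht).trans (le_max_right _ _)).trans (Real.le_coe_toNNReal _)
  obtain ⟨R, hR⟩ : ∃ R : NNReal, (R : ℝ) = ‖z‖ * Real.exp (K * n) :=
    ⟨⟨_, by positivity⟩, rfl⟩
  let N : NNReal := ⟨n, hn.le⟩
  let c : ℝ → ℝ := fun y => max (-(R : ℝ)) (min R y)
  have hc_lip : ∀ x y, |c x - c y| ≤ |x - y| := fun x y => by
    simp only [c]
    rw [max_comm, max_comm _ (min (R : ℝ) y)]
    refine (abs_max_sub_max_le_abs _ _ _).trans ?_
    exact (abs_min_sub_min_le_max (R : ℝ) x R y).trans (by simp)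
  have hR0 : (0 : ℝ) ≤ R := R.2
  have hc_le : ∀ x, |c x| ≤ R := fun x => by
    rw [abs_le]; exact ⟨le_max_left _ _, max_le (by linarith) (min_le_left _ _)⟩
  have hc_abs : ∀ x, |c x| ≤ |x| := fun x => by
    have := hc_lip x 0
    have h0 : c 0 = 0 := by simp [c]
    simpa [h0] using this
  have hc_id : ∀ x : ℝ, |x| ≤ R → c x = x := fun x hx => by
    rw [abs_le] at hx; simp [c, hx.1, hx.2]
  let v : ℝ → ℝ × ℝ → ℝ × ℝ := fun t y => (u t * c y.2, w t * c y.1)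
  have hv_norm : ∀ t ∈ Icc (-n) n, ∀ y, ‖v t y‖ ≤ K * R := fun t ht y => by
    rw [Prod.norm_def]
    simp only [v, Real.norm_eq_abs, abs_mul]
    exact max_le (mul_le_mul (hKu t ht) (hc_le _) (abs_nonneg _) K.2)
      (mul_le_mul (hKw t ht) (hc_le _) (abs_nonneg _) K.2)
  have hv_norm' : ∀ t ∈ Icc (-n) n, ∀ y, ‖v t y‖ ≤ K * ‖y‖ := fun t ht y => by
    rw [Prod.norm_def]
    simp only [v, Real.norm_eq_abs, abs_mul]
    exact max_le
      (mul_le_mul (hKu t ht) ((hc_abs _).trans (norm_snd_le y)) (abs_nonneg _) K.2)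
      (mul_le_mul (hKw t ht) ((hc_abs _).trans (norm_fst_le y)) (abs_nonneg _) K.2)
  have hPL : IsPicardLindelof v (tmin := -n) (tmax := n) ⟨0, by constructor <;> linarith⟩ z
      (K * R * N) 0 (K * R) K := by
    refine ⟨fun t ht => ?_, fun x _ => ?_, fun t ht x _ => hv_norm t ht x, ?_⟩
    · refine LipschitzWith.lipschitzOnWith (LipschitzWith.of_dist_le_mul fun x y => ?_)
      rw [dist_eq_norm, dist_eq_norm, Prod.norm_def]
      simp only [v, Prod.fst_sub, Prod.snd_sub, Real.norm_eq_abs, ← mul_sub, abs_mul]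
      exact max_le
        (mul_le_mul (hKu t ht) ((hc_lip _ _).trans (norm_snd_le (x - y))) (abs_nonneg _) K.2)
        (mul_le_mul (hKw t ht) ((hc_lip _ _).trans (norm_fst_le (x - y))) (abs_nonneg _) K.2)
    · exact ((hu.mul continuous_const).prodMk (hw.mul continuous_const)).continuousOn
    · simp only [NNReal.coe_mul, NNReal.coe_zero, sub_zero, zero_sub, neg_neg, max_self]
      exact le_rfl
  obtain ⟨γ, hγ0, hγ⟩ := hPL.exists_eq_forall_mem_Icc_hasDerivWithinAt₀
  simp only at hγ0
  have hd : ∀ t ∈ Ioo (-n) n, HasDerivAt γ (v t (γ t)) t := fun t ht =>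
    (hγ t (Ioo_subset_Icc_self ht)).hasDerivAt (Icc_mem_nhds ht.1 ht.2)
  have hcont : ContinuousOn γ (Icc (-n) n) := fun t ht => (hγ t ht).continuousWithinAt
  have hexp : ∀ t, 0 ≤ t → t < n → gronwallBound ‖z‖ K 0 (t - 0) ≤ R := fun t _ ht' => by
    rw [gronwallBound_ε0, hR, sub_zero]
    gcongr
  have hpos : ∀ t, 0 ≤ t → t < n → ‖γ t‖ ≤ R := fun t ht ht' => by
    refine (norm_le_gronwallBound_of_norm_deriv_right_le (f := γ) (f' := fun s => v s (γ s))
      (δ := ‖z‖) (K := K) (ε := 0) (a := 0) (b := t) ?_ ?_ (by rw [hγ0]) ?_ t ⟨ht, le_rfl⟩).trans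
      (hexp t ht ht')
    · exact hcont.mono fun s hs => ⟨by linarith [hs.1], by linarith [hs.2]⟩
    · exact fun s hs => (hd s ⟨by linarith [hs.1], by linarith [hs.2]⟩).hasDerivWithinAt
    · intro s hs
      simpa using hv_norm' s ⟨by linarith [hs.1], by linarith [hs.2]⟩ (γ s)
  have hneg : ∀ t, 0 ≤ t → t < n → ‖γ (-t)‖ ≤ R := fun t ht ht' => by
    refine (norm_le_gronwallBound_of_norm_deriv_right_le (f := fun s => γ (-s))
      (f' := fun s => -v (-s) (γ (-s)))
      (δ := ‖z‖) (K := K) (ε := 0) (a := 0) (b := t) ?_ ?_ (by simp [hγ0]) ?_ t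
      ⟨ht, le_rfl⟩).trans (hexp t ht ht')
    · exact hcont.comp continuousOn_neg fun s hs => ⟨by linarith [hs.2], by linarith [hs.1]⟩
    · intro s hs
      have h := hd (-s) ⟨by linarith [hs.2], by linarith [hs.1]⟩
      have := HasDerivAt.scomp s h (hasDerivAt_neg s)
      simpa [Function.comp_def] using this.hasDerivWithinAt (s := Ici s)
    · intro s hs
      simpa using hv_norm' (-s) ⟨by linarith [hs.2], by linarith [hs.1]⟩ (γ (-s))
  refine ⟨γ, hγ0, fun t ht => ?_⟩
  have hb : ‖γ t‖ ≤ R := by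
    rcases le_total 0 t with h | h
    · exact hpos t h ht.2
    · simpa using hneg (-t) (by linarith) (by linarith [ht.1])
  have := hd t ht
  simpa only [v, hc_id _ ((norm_snd_le (γ t)).trans hb), hc_id _ ((norm_fst_le (γ t)).trans hb)]
    using this

/-- Uniqueness on `(-n, n)` for a planar linear system with continuous coefficients. -/
theorem linearSystem_unique_Ioo (u w : ℝ → ℝ) (hu : Continuous u) (hw : Continuous w)
    (n : ℝ) (hn : 0 < n) (γ δ : ℝ → ℝ × ℝ) (h0 : γ 0 = δ 0)
    (hγ : ∀ t ∈ Ioo (-n) n, HasDerivAt γ (u t * (γ t).2, w t * (γ t).1) t)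
    (hδ : ∀ t ∈ Ioo (-n) n, HasDerivAt δ (u t * (δ t).2, w t * (δ t).1) t) :
    EqOn γ δ (Ioo (-n) n) := by
  obtain ⟨K₁, hK₁⟩ := (isCompact_Icc (a := -n) (b := n)).exists_bound_of_continuousOn hu.continuousOn
  obtain ⟨K₂, hK₂⟩ := (isCompact_Icc (a := -n) (b := n)).exists_bound_of_continuousOn hw.continuousOn
  refine ODE_solution_unique_of_mem_Ioo (v := fun t y => (u t * y.2, w t * y.1))
    (s := fun _ => univ) (K := (max K₁ K₂).toNNReal) (t₀ := 0) (fun t ht => ?_)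
    ⟨by linarith, hn⟩ (fun t ht => ⟨hγ t ht, trivial⟩) (fun t ht => ⟨hδ t ht, trivial⟩) h0
  have ht' := Ioo_subset_Icc_self ht
  refine LipschitzWith.lipschitzOnWith (LipschitzWith.of_dist_le_mul fun x y => ?_)
  rw [dist_eq_norm, dist_eq_norm, Prod.norm_def]
  simp only [Prod.fst_sub, Prod.snd_sub, ← mul_sub, norm_mul]
  exact max_le
    (mul_le_mul (((hK₁ t ht').trans (le_max_left _ _)).trans (Real.le_coe_toNNReal _))
      (norm_snd_le (x - y)) (norm_nonneg _) (NNReal.coe_nonneg _))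
    (mul_le_mul (((hK₂ t ht').trans (le_max_right _ _)).trans (Real.le_coe_toNNReal _))
      (norm_fst_le (x - y)) (norm_nonneg _) (NNReal.coe_nonneg _))

/-- A planar linear system with continuous coefficients has a global solution. -/
theorem linearSystem_exists (u w : ℝ → ℝ) (hu : Continuous u) (hw : Continuous w)
    (z : ℝ × ℝ) :
    ∃ γ : ℝ → ℝ × ℝ, γ 0 = z ∧ ∀ t, HasDerivAt γ (u t * (γ t).2, w t * (γ t).1) t := by
  have h : ∀ n : ℝ, ∃ γ : ℝ → ℝ × ℝ, 0 < n → γ 0 = z ∧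
      ∀ t ∈ Ioo (-n) n, HasDerivAt γ (u t * (γ t).2, w t * (γ t).1) t := fun n => by
    by_cases hn : 0 < n
    · obtain ⟨γ, hγ⟩ := linearSystem_exists_Ioo u w hu hw z n hn
      exact ⟨γ, fun _ => hγ⟩
    · exact ⟨fun _ => 0, fun h => absurd h hn⟩
  choose γ hγ using h
  have key : ∀ m n : ℝ, 0 < m → m ≤ n → EqOn (γ m) (γ n) (Ioo (-m) m) := fun m n hm hmn =>
    linearSystem_unique_Ioo u w hu hw m hm _ _
      (by rw [(hγ m hm).1, (hγ n (hm.trans_le hmn)).1]) (hγ m hm).2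
      (fun t ht => (hγ n (hm.trans_le hmn)).2 t ⟨by linarith [ht.1], by linarith [ht.2]⟩)
  refine ⟨fun t => γ (|t| + 1) t, by simpa using (hγ (|0| + 1) (by positivity)).1, fun t => ?_⟩
  have hpos : 0 < |t| + 2 := by positivity
  have hmem : t ∈ Ioo (-(|t| + 1)) (|t| + 1) := by
    constructor
    · linarith [neg_abs_le t]
    · linarith [le_abs_self t]
  have heq : ∀ s ∈ Ioo (-(|t| + 1)) (|t| + 1), γ (|s| + 1) s = γ (|t| + 2) s := fun s hs => by
    have hs' : |s| < |t| + 1 := abs_lt.2 hs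
    refine key (|s| + 1) (|t| + 2) (by positivity) (by linarith) ⟨?_, ?_⟩
    · linarith [neg_abs_le s]
    · linarith [le_abs_self s]
  have hd := (hγ (|t| + 2) hpos).2 t ⟨by linarith [hmem.1], by linarith [hmem.2]⟩
  simp only
  rw [heq t hmem]
  exact hd.congr_of_eventuallyEq
    (Filter.eventually_of_mem (Ioo_mem_nhds hmem.1 hmem.2) heq)

/-- Existence and uniqueness for the initial value problem of `-(p f')' + q f = lam f`. -/
theorem existsUnique_hillIVP (p q : ℝ → ℝ) (hp : Continuous p) (hp_pos : ∀ x, 0 < p x)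
    (hq : Continuous q) (lam a b : ℝ) : ∃! f, IsHillIVPSolution p q lam a b f := by
  have hu : Continuous fun t => (p t)⁻¹ := hp.inv₀ fun x => (hp_pos x).ne'
  have hw : Continuous fun t => q t - lam := hq.sub continuous_const
  obtain ⟨γ, hγ0, hγ⟩ := linearSystem_exists _ _ hu hw (a, p 0 * b)
  have h1 : ∀ t, HasDerivAt (fun t => (γ t).1) ((p t)⁻¹ * (γ t).2) t := fun t => (hγ t).fst
  have h2 : ∀ t, HasDerivAt (fun t => (γ t).2) ((q t - lam) * (γ t).1) t := fun t => (hγ t).snd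
  have h3 : (fun y => p y * deriv (fun t => (γ t).1) y) = fun t => (γ t).2 := by
    funext y
    rw [(h1 y).deriv, mul_inv_cancel_left₀ (hp_pos y).ne']
  refine ⟨fun t => (γ t).1, ⟨⟨?_, ?_, ?_⟩, by simp [hγ0], ?_⟩, ?_⟩
  · exact fun t _ => (h1 t).differentiableAt.differentiableWithinAt
  · simp only [derivWithin_univ, h3]
    exact fun t _ => (h2 t).differentiableAt.differentiableWithinAt
  · intro x _
    simp only [derivWithin_univ, h3, (h2 x).deriv]
    ring
  · rw [(h1 0).deriv, hγ0, inv_mul_cancel_left₀ (hp_pos 0).ne']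
  · rintro g ⟨⟨hg1, hg2, hg3⟩, hg0, hg0'⟩
    simp only [derivWithin_univ] at hg2 hg3
    have hgd : ∀ t, HasDerivAt (fun t => (g t, p t * deriv g t))
        ((p t)⁻¹ * (p t * deriv g t), (q t - lam) * g t) t := fun t => by
      refine HasDerivAt.prodMk ?_ ?_
      · rw [inv_mul_cancel_left₀ (hp_pos t).ne']
        exact (hg1.differentiableAt univ_mem).hasDerivAt
      · have h := (hg2.differentiableAt (x := t) univ_mem).hasDerivAt
        have e := hg3 t trivial
        convert h using 1
        linarith
    funext t
    have hn : 0 < |t| + 1 := by positivity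
    have := linearSystem_unique_Ioo _ _ hu hw (|t| + 1) hn
      (fun t => (g t, p t * deriv g t)) γ (by simp [hγ0, hg0, hg0'])
      (fun t _ => hgd t) (fun t _ => hγ t)
    have ht : t ∈ Ioo (-(|t| + 1)) (|t| + 1) := ⟨by linarith [neg_abs_le t], by linarith [le_abs_self t]⟩
    exact congrArg Prod.fst (this ht)

/-- The solution of `-(p f')' + q f = lam f` on the line with `f 0 = a`, `f' 0 = b`
(it exists and is unique, see `existsUnique_hillIVP`). -/
noncomputable def hillIVP (p q : ℝ → ℝ) (lam a b : ℝ) : ℝ → ℝ :=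
  Classical.epsilon (IsHillIVPSolution p q lam a b)

theorem hillIVP_spec (p q : ℝ → ℝ) (hp : Continuous p) (hp_pos : ∀ x, 0 < p x)
    (hq : Continuous q) (lam a b : ℝ) : IsHillIVPSolution p q lam a b (hillIVP p q lam a b) :=
  Classical.epsilon_spec (existsUnique_hillIVP p q hp hp_pos hq lam a b).exists

/-- The fundamental solution `f₁(·, lam)`: `f₁ 0 = 1`, `f₁' 0 = 0`. -/
noncomputable def hillF1 (p q : ℝ → ℝ) (lam : ℝ) : ℝ → ℝ := hillIVP p q lam 1 0

/-- The fundamental solution `f₂(·, lam)`: `f₂ 0 = 0`, `f₂' 0 = 1`. -/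
noncomputable def hillF2 (p q : ℝ → ℝ) (lam : ℝ) : ℝ → ℝ := hillIVP p q lam 0 1

/-- Hill's discriminant `D(lam) = f₁(T, lam) + f₂'(T, lam)`. -/
noncomputable def hillDiscriminant (p q : ℝ → ℝ) (T lam : ℝ) : ℝ :=
  hillF1 p q lam T + deriv (hillF2 p q lam) T

/-- `f` is an eigenfunction, with eigenvalue `lam`, of `-(p f')' + q f` on the segment `[0, T]`
with periodic boundary conditions `f 0 = f T`, `f' 0 = f' T`. -/
structure IsPeriodicEigenfunction (p q : ℝ → ℝ) (T lam : ℝ) (f : ℝ → ℝ) : Prop where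
  sol : IsHillSolutionOn p q lam (Icc 0 T) f
  ne_zero : ∃ x ∈ Icc 0 T, f x ≠ 0
  bdry : f 0 = f T
  bdry_deriv : derivWithin f (Icc 0 T) 0 = derivWithin f (Icc 0 T) T

/-- The set of eigenvalues of the periodic Sturm–Liouville problem on `[0, T]`. -/
def periodicEigenvalues (p q : ℝ → ℝ) (T : ℝ) : Set ℝ :=
  {lam | ∃ f : ℝ → ℝ, IsPeriodicEigenfunction p q T lam f}

/-- The iterated integrals `X̃⁽ⁿ⁾`. -/
noncomputable def sppsXTilde (p f₀ : ℝ → ℝ) : ℕ → ℝ → ℝ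
  | 0 => fun _ => 1
  | n + 1 => fun x =>
      if Odd (n + 1) then ∫ ξ in (0 : ℝ)..x, sppsXTilde p f₀ n ξ * f₀ ξ ^ 2
      else -∫ ξ in (0 : ℝ)..x, sppsXTilde p f₀ n ξ * (1 / (p ξ * f₀ ξ ^ 2))

/-- The iterated integrals `X⁽ⁿ⁾`. -/
noncomputable def sppsX (p f₀ : ℝ → ℝ) : ℕ → ℝ → ℝ
  | 0 => fun _ => 1
  | n + 1 => fun x =>
      if Odd (n + 1) then -∫ ξ in (0 : ℝ)..x, sppsX p f₀ n ξ * (1 / (p ξ * f₀ ξ ^ 2))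
      else ∫ ξ in (0 : ℝ)..x, sppsX p f₀ n ξ * f₀ ξ ^ 2

/-! With `g = p f'` the equation becomes a planar system whose monodromy matrix over one period has
determinant `1` and trace `D(lam)`.

No zeros. A value of `lam` with trace `2` is a periodic eigenvalue, and the trace is at least `2`
when `lam ≤ q` everywhere. Suppose the lowest eigenfunction vanishes at `c`. Follow the solution
`φ(lam, ·)` with `φ = 0` and `p φ' = 1` at `c`: for low `lam` it is positive on `(c, c + T]`, while
at `lam₀` it is a multiple of the eigenfunction and vanishes at `c + T`. At the supremum `lam₁` of
the parameters keeping it positive, it vanishes at `c + T` with negative slope, so it is multiplied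
by some `ρ < 0` over a period, and the trace there is `ρ + 1/ρ < 0`. By the intermediate value
theorem the trace equals `2` at a point strictly below `lam₁ ≤ lam₀`, contradicting minimality
(`exists_trace_neg`, `ne_zero_of_isLeast`).

Series. Let `h` be the periodic extension of `f₀`, with `k = p h'`, and let `(f, g)` be a solution
for `lam`. The quotient `f / h` and the Wronskian `h g - k f` satisfy a planar system with weights
`h ^ 2` and `1 / (p h ^ 2)`, coupled through `lam - lam₀`. Picard iteration gives the power series
of iterated integrals, with factorial bounds (`hasSum_alternatingIntegral`). One choice of initial
data yields the `X̃` series through the quotient, another the `X` series through the Wronskian; at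
`T` the two values add up to the trace (`hasSum_trace`). -/

/-! ### The first-order system -/

/-- The pair `(f, g)` solves the first-order system `f' = g / p`, `g' = (q - lam) f` which is
equivalent to `-(p f')' + q f = lam f` with `g = p f'`. -/
structure IsHillPair (p q : ℝ → ℝ) (lam : ℝ) (f g : ℝ → ℝ) : Prop where
  hasDerivAt_fst : ∀ t, HasDerivAt f (g t / p t) t
  hasDerivAt_snd : ∀ t, HasDerivAt g ((q t - lam) * f t) t

namespace IsHillPair

variable {p q : ℝ → ℝ} {lam : ℝ} {f g f' g' : ℝ → ℝ}

theorem continuous_fst (h : IsHillPair p q lam f g) : Continuous f :=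
  continuous_iff_continuousAt.2 fun t => (h.hasDerivAt_fst t).continuousAt

theorem continuous_snd (h : IsHillPair p q lam f g) : Continuous g :=
  continuous_iff_continuousAt.2 fun t => (h.hasDerivAt_snd t).continuousAt

theorem zero : IsHillPair p q lam (fun _ => 0) (fun _ => 0) where
  hasDerivAt_fst t := by simpa using hasDerivAt_const t (0 : ℝ)
  hasDerivAt_snd t := by simpa using hasDerivAt_const t (0 : ℝ)

theorem comb (h : IsHillPair p q lam f g) (h' : IsHillPair p q lam f' g') (a b : ℝ) :
    IsHillPair p q lam (fun x => a * f x + b * f' x) (fun x => a * g x + b * g' x) where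
  hasDerivAt_fst t := by
    refine HasDerivAt.congr_deriv (((h.hasDerivAt_fst t).const_mul a).add ((h'.hasDerivAt_fst t).const_mul b)) ?_
    ring
  hasDerivAt_snd t := by
    refine HasDerivAt.congr_deriv (((h.hasDerivAt_snd t).const_mul a).add ((h'.hasDerivAt_snd t).const_mul b)) ?_
    ring

theorem shift {T : ℝ} (hp : Function.Periodic p T) (hq : Function.Periodic q T)
    (h : IsHillPair p q lam f g) :
    IsHillPair p q lam (fun x => f (x + T)) (fun x => g (x + T)) where
  hasDerivAt_fst t := by
    have := (h.hasDerivAt_fst (t + T)).comp_add_const t T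
    rwa [hp t] at this
  hasDerivAt_snd t := by
    have := (h.hasDerivAt_snd (t + T)).comp_add_const t T
    rwa [hq t] at this

/-- The coefficient matrix has zero trace. All uniqueness statements below rest on this conservation
law. -/
theorem wronskian_eq (h : IsHillPair p q lam f g) (h' : IsHillPair p q lam f' g') (x y : ℝ) :
    f x * g' x - g x * f' x = f y * g' y - g y * f' y := by
  have hd : ∀ t, HasDerivAt (fun x => f x * g' x - g x * f' x) 0 t := fun t => by
    refine HasDerivAt.congr_deriv (((h.hasDerivAt_fst t).mul (h'.hasDerivAt_snd t)).sub
      ((h.hasDerivAt_snd t).mul (h'.hasDerivAt_fst t))) ?_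
    ring
  exact is_const_of_deriv_eq_zero (fun t => (hd t).differentiableAt) (fun t => (hd t).deriv) x y

/-- On a half-line where `lam ≤ q`, the product `f g` and both squares are nondecreasing. -/
theorem sq_le_sq (hp : ∀ x, 0 < p x) (hq : ∀ x, lam ≤ q x) (h : IsHillPair p q lam f g)
    {s : ℝ} (hs : 0 ≤ f s * g s) {x : ℝ} (hx : s ≤ x) :
    f s ^ 2 ≤ f x ^ 2 ∧ g s ^ 2 ≤ g x ^ 2 := by
  have d1 : ∀ t, HasDerivAt (fun x => f x * g x) (g t ^ 2 / p t + (q t - lam) * f t ^ 2) t :=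
    fun t => by
      refine HasDerivAt.congr_deriv ((h.hasDerivAt_fst t).mul (h.hasDerivAt_snd t)) ?_
      ring
  have m1 : Monotone fun x => f x * g x :=
    monotone_of_deriv_nonneg (fun t => (d1 t).differentiableAt) fun t => by
      rw [(d1 t).deriv]
      have := (hp t).le
      have := sub_nonneg.2 (hq t)
      positivity
  have hfg : ∀ t, s ≤ t → 0 ≤ f t * g t := fun t ht => hs.trans (m1 ht)
  have d2 : ∀ t, HasDerivAt (fun x => f x ^ 2) (2 * (f t * g t) / p t) t := fun t => by
    refine HasDerivAt.congr_deriv ((h.hasDerivAt_fst t).pow 2) ?_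
    push_cast
    ring
  have d3 : ∀ t, HasDerivAt (fun x => g x ^ 2) (2 * (f t * g t) * (q t - lam)) t := fun t => by
    refine HasDerivAt.congr_deriv ((h.hasDerivAt_snd t).pow 2) ?_
    push_cast
    ring
  constructor
  · refine monotoneOn_of_deriv_nonneg (convex_Ici s) (h.continuous_fst.pow 2).continuousOn
      (fun t _ => (d2 t).differentiableAt.differentiableWithinAt) (fun t ht => ?_)
      self_mem_Ici hx hx
    change 0 ≤ deriv (fun x => f x ^ 2) t
    rw [(d2 t).deriv]
    rw [interior_Ici] at ht
    exact div_nonneg (mul_nonneg zero_le_two (hfg t (le_of_lt ht))) (hp t).le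
  · refine monotoneOn_of_deriv_nonneg (convex_Ici s) (h.continuous_snd.pow 2).continuousOn
      (fun t _ => (d3 t).differentiableAt.differentiableWithinAt) (fun t ht => ?_)
      self_mem_Ici hx hx
    change 0 ≤ deriv (fun x => g x ^ 2) t
    rw [(d3 t).deriv]
    rw [interior_Ici] at ht
    exact mul_nonneg (mul_nonneg zero_le_two (hfg t (le_of_lt ht))) (sub_nonneg.2 (hq t))

end IsHillPair

/-- A continuous function with `f s = 1` and `1 ≤ f ^ 2` on `[s, ∞)` is at least `1` there. -/
theorem one_le_of_one_le_sq {f : ℝ → ℝ} (hf : Continuous f) {s : ℝ} (hs : f s = 1)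
    (h : ∀ x, s ≤ x → 1 ≤ f x ^ 2) {x : ℝ} (hx : s ≤ x) : 1 ≤ f x := by
  by_contra! hlt
  have hneg : f x ≤ 0 := by nlinarith [h x hx]
  obtain ⟨y, hy, hy0⟩ := intermediate_value_Icc' hx hf.continuousOn ⟨hneg, hs ▸ zero_le_one⟩
  have := h y hy.1
  rw [hy0] at this
  norm_num at this

/-! ### Dependence on the spectral parameter -/

/-- Initial data at `0` determine a family of solutions depending in a locally Lipschitz way on the
spectral parameter, uniformly on bounded intervals. -/
theorem IsHillPair.exists_lipschitz {p q : ℝ → ℝ} (hp : Continuous p) (hp_pos : ∀ x, 0 < p x)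
    (hq : Continuous q) {f g : ℝ → ℝ → ℝ} (h : ∀ lam, IsHillPair p q lam (f lam) (g lam))
    {a b : ℝ} (hf0 : ∀ lam, f lam 0 = a) (hg0 : ∀ lam, g lam 0 = b) (lam₁ L : ℝ) :
    ∃ C, ∀ lam, |lam - lam₁| ≤ 1 → ∀ x ∈ Icc 0 L,
      |f lam x - f lam₁ x| ≤ C * |lam - lam₁| ∧ |g lam x - g lam₁ x| ≤ C * |lam - lam₁| := by
  have hu : Continuous fun t => (p t)⁻¹ := hp.inv₀ fun x => (hp_pos x).ne'
  obtain ⟨K₁, hK₁⟩ := (isCompact_Icc (a := 0) (b := L)).exists_bound_of_continuousOn hu.continuousOn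
  obtain ⟨K₂, hK₂⟩ := (isCompact_Icc (a := 0) (b := L)).exists_bound_of_continuousOn
    (hq.sub (continuous_const (y := lam₁))).continuousOn
  obtain ⟨M, hM⟩ := (isCompact_Icc (a := 0) (b := L)).exists_bound_of_continuousOn
    (h lam₁).continuous_fst.continuousOn
  obtain ⟨K, hK0, hKu, hKw⟩ : ∃ K : ℝ, 0 < K ∧ (∀ t ∈ Icc 0 L, |(p t)⁻¹| ≤ K) ∧
      ∀ t ∈ Icc 0 L, ∀ lam, |lam - lam₁| ≤ 1 → |q t - lam| ≤ K := by
    -- The `1` makes `K` positive, as division by `K` in the Gronwall bound requires; `K₂ + 1`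
    -- bounds `|q - lam|` for all `lam` within distance `1` of `lam₁`.
    refine ⟨max 1 (max K₁ (K₂ + 1)), by positivity, fun t ht => ?_, fun t ht lam hlam => ?_⟩
    · exact (hK₁ t ht).trans ((le_max_left _ _).trans (le_max_right _ _))
    · refine le_trans ?_ ((le_max_right _ _).trans (le_max_right _ _))
      have h1 := hK₂ t ht
      change |q t - lam₁| ≤ K₂ at h1
      rw [abs_le] at *
      constructor <;> linarith [h1.1, h1.2, hlam.1, hlam.2]
  refine ⟨M / K * (Real.exp (K * L) - 1), fun lam hlam x hx => ?_⟩
  have hM0 : 0 ≤ M := (norm_nonneg _).trans (hM x hx)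
  have key := norm_le_gronwallBound_of_norm_deriv_right_le
    (f := fun t => (f lam t - f lam₁ t, g lam t - g lam₁ t))
    (f' := fun t => (g lam t / p t - g lam₁ t / p t,
      (q t - lam) * f lam t - (q t - lam₁) * f lam₁ t))
    (δ := 0) (K := K) (ε := M * |lam - lam₁|) (a := 0) (b := L)
    (((h lam).continuous_fst.sub (h lam₁).continuous_fst).prodMk
      ((h lam).continuous_snd.sub (h lam₁).continuous_snd)).continuousOn
    (fun t _ => ((((h lam).hasDerivAt_fst t).sub ((h lam₁).hasDerivAt_fst t)).prodMk
      (((h lam).hasDerivAt_snd t).sub ((h lam₁).hasDerivAt_snd t))).hasDerivWithinAt)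
    (by simp [hf0, hg0]) (fun t ht => ?_) x hx
  · rw [gronwallBound_of_K_ne_0 hK0.ne', Prod.norm_def] at key
    simp only [zero_mul, zero_add, sub_zero] at key
    have hle : M * |lam - lam₁| / K * (Real.exp (K * x) - 1) ≤
        M / K * (Real.exp (K * L) - 1) * |lam - lam₁| := by
      rw [mul_div_right_comm, mul_assoc, mul_assoc, mul_comm (|lam - lam₁|)]
      gcongr
      exact hx.2
    exact ⟨(le_max_left _ _).trans (key.trans hle), (le_max_right _ _).trans (key.trans hle)⟩
  · have ht' := Ico_subset_Icc_self ht
    rw [Prod.norm_def, Prod.norm_def]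
    simp only [Real.norm_eq_abs]
    have e1 : g lam t / p t - g lam₁ t / p t = (p t)⁻¹ * (g lam t - g lam₁ t) := by
      rw [div_eq_inv_mul, div_eq_inv_mul, mul_sub]
    -- The difference of two solutions solves the system for `lam` with forcing term `f lam₁ t *
    -- (lam₁ - lam)`; this is the `ε` of the Gronwall estimate.
    have e2 : (q t - lam) * f lam t - (q t - lam₁) * f lam₁ t =
        (q t - lam) * (f lam t - f lam₁ t) + f lam₁ t * (lam₁ - lam) := by ring
    refine max_le ?_ ?_
    · rw [e1, abs_mul]
      have : |(p t)⁻¹| * |g lam t - g lam₁ t| ≤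
          K * max |f lam t - f lam₁ t| |g lam t - g lam₁ t| :=
        mul_le_mul (hKu t ht') (le_max_right _ _) (abs_nonneg _) hK0.le
      have := mul_nonneg hM0 (abs_nonneg (lam - lam₁))
      linarith
    · rw [e2]
      refine (abs_add_le _ _).trans (add_le_add ?_ ?_)
      · rw [abs_mul]
        exact mul_le_mul (hKw t ht' lam hlam) (le_max_left _ _) (abs_nonneg _) hK0.le
      · rw [abs_mul, abs_sub_comm lam₁]
        exact mul_le_mul_of_nonneg_right (hM t ht') (abs_nonneg _)

theorem continuousAt_uncurry_of_lipschitz {f : ℝ → ℝ → ℝ} {lam₁ x₁ L C : ℝ}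
    (hx : x₁ ∈ Ioo 0 L) (hf : Continuous (f lam₁))
    (hC : ∀ lam, |lam - lam₁| ≤ 1 → ∀ x ∈ Icc 0 L, |f lam x - f lam₁ x| ≤ C * |lam - lam₁|) :
    ContinuousAt (fun z : ℝ × ℝ => f z.1 z.2) (lam₁, x₁) := by
  have h1 : Tendsto (fun z : ℝ × ℝ => f lam₁ z.2) (𝓝 (lam₁, x₁)) (𝓝 (f lam₁ x₁)) :=
    (hf.comp continuous_snd).tendsto _
  have h2 : Tendsto (fun z : ℝ × ℝ => f z.1 z.2 - f lam₁ z.2) (𝓝 (lam₁, x₁)) (𝓝 0) := by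
    refine squeeze_zero_norm' (a := fun z : ℝ × ℝ => C * |z.1 - lam₁|) ?_ ?_
    · have e1 : ∀ᶠ z : ℝ × ℝ in 𝓝 (lam₁, x₁), z.1 ∈ Metric.closedBall lam₁ 1 :=
        continuous_fst.tendsto (lam₁, x₁) |>.eventually (Metric.closedBall_mem_nhds lam₁ one_pos)
      have e2 : ∀ᶠ z : ℝ × ℝ in 𝓝 (lam₁, x₁), z.2 ∈ Icc 0 L :=
        continuous_snd.tendsto (lam₁, x₁) |>.eventually (Icc_mem_nhds hx.1 hx.2)
      filter_upwards [e1, e2] with z hz1 hz2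
      exact hC z.1 (by simpa [Real.dist_eq] using hz1) z.2 hz2
    · have : Continuous fun z : ℝ × ℝ => C * |z.1 - lam₁| := by fun_prop
      simpa using this.tendsto (lam₁, x₁)
  have := h2.add h1
  simp only [sub_add_cancel, zero_add] at this
  exact this

/-- The solutions depend continuously on the spectral parameter and on the point jointly. -/
theorem IsHillPair.continuousAt_uncurry {p q : ℝ → ℝ} (hp : Continuous p) (hp_pos : ∀ x, 0 < p x)
    (hq : Continuous q) {f g : ℝ → ℝ → ℝ} (h : ∀ lam, IsHillPair p q lam (f lam) (g lam))
    {a b : ℝ} (hf0 : ∀ lam, f lam 0 = a) (hg0 : ∀ lam, g lam 0 = b) {z : ℝ × ℝ} (hz : 0 < z.2) :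
    ContinuousAt (fun z : ℝ × ℝ => f z.1 z.2) z ∧ ContinuousAt (fun z : ℝ × ℝ => g z.1 z.2) z := by
  obtain ⟨C, hC⟩ := IsHillPair.exists_lipschitz hp hp_pos hq h hf0 hg0 z.1 (z.2 + 1)
  have hx : z.2 ∈ Ioo 0 (z.2 + 1) := ⟨hz, lt_add_one _⟩
  exact ⟨continuousAt_uncurry_of_lipschitz hx (h z.1).continuous_fst
      fun lam hl x hx => (hC lam hl x hx).1,
    continuousAt_uncurry_of_lipschitz hx (h z.1).continuous_snd
      fun lam hl x hx => (hC lam hl x hx).2⟩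

/-! ### Fundamental systems, monodromy and periodic eigenfunctions -/

/-- A fundamental system, for each value of the spectral parameter. -/
structure IsHillFundamental (p q : ℝ → ℝ) (F₁ G₁ F₂ G₂ : ℝ → ℝ → ℝ) : Prop where
  fst : ∀ lam, IsHillPair p q lam (F₁ lam) (G₁ lam)
  snd : ∀ lam, IsHillPair p q lam (F₂ lam) (G₂ lam)
  F₁_zero : ∀ lam, F₁ lam 0 = 1
  G₁_zero : ∀ lam, G₁ lam 0 = 0
  F₂_zero : ∀ lam, F₂ lam 0 = 0
  G₂_zero : ∀ lam, G₂ lam 0 = 1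

/-- A solution of the initial value problem yields a solution of the first-order system. -/
theorem IsHillIVPSolution.isHillPair {p q : ℝ → ℝ} {lam a b : ℝ} {f : ℝ → ℝ}
    (hp : ∀ x, 0 < p x) (h : IsHillIVPSolution p q lam a b f) :
    IsHillPair p q lam f fun x => p x * deriv f x := by
  obtain ⟨⟨h1, h2, h3⟩, -, -⟩ := h
  simp only [derivWithin_univ] at h2 h3
  refine ⟨fun t => ?_, fun t => ?_⟩
  · rw [mul_div_cancel_left₀ _ (hp t).ne']
    exact (h1.differentiableAt univ_mem).hasDerivAt
  · have h := (h2.differentiableAt (x := t) univ_mem).hasDerivAt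
    refine HasDerivAt.congr_deriv h ?_
    linarith [h3 t trivial]

/-- The second solution is `f₂` divided by `p 0`, which normalizes its quasi-derivative to `1` at
`0`. Since `p T = p 0`, its quasi-derivative at `T` is exactly `f₂'(T)`, so the trace is the
discriminant. The summands with factor `0` come from using `comb` for a mere scaling. -/
theorem exists_isHillFundamental {p q : ℝ → ℝ} {T : ℝ} (hp : Continuous p)
    (hp_pos : ∀ x, 0 < p x) (hq : Continuous q) (hpT : p T = p 0) :
    ∃ F₁ G₁ F₂ G₂ : ℝ → ℝ → ℝ, IsHillFundamental p q F₁ G₁ F₂ G₂ ∧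
      ∀ lam, hillDiscriminant p q T lam = F₁ lam T + G₂ lam T := by
  have s1 := fun lam => hillIVP_spec p q hp hp_pos hq lam 1 0
  have s2 := fun lam => hillIVP_spec p q hp hp_pos hq lam 0 1
  have hp0 := (hp_pos 0).ne'
  refine ⟨fun lam => hillF1 p q lam, fun lam x => p x * deriv (hillF1 p q lam) x,
    fun lam x => 0 * hillF2 p q lam x + (p 0)⁻¹ * hillF2 p q lam x,
    fun lam x => 0 * (p x * deriv (hillF2 p q lam) x) + (p 0)⁻¹ * (p x * deriv (hillF2 p q lam) x),
    ⟨fun lam => (s1 lam).isHillPair hp_pos,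
      fun lam => ((s2 lam).isHillPair hp_pos).comb ((s2 lam).isHillPair hp_pos) _ _,
      fun lam => (s1 lam).2.1, fun lam => ?_, fun lam => ?_, fun lam => ?_⟩, fun lam => ?_⟩
  · change p 0 * deriv (hillIVP p q lam 1 0) 0 = 0
    rw [(s1 lam).2.2, mul_zero]
  · change 0 * hillIVP p q lam 0 1 0 + (p 0)⁻¹ * hillIVP p q lam 0 1 0 = 0
    simp [(s2 lam).2.1]
  · change 0 * (p 0 * deriv (hillIVP p q lam 0 1) 0) + (p 0)⁻¹ * (p 0 * deriv (hillIVP p q lam 0 1) 0) = 1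
    rw [(s2 lam).2.2]
    field_simp
    simp
  · rw [hillDiscriminant]
    simp [hpT, hp0]

namespace IsHillFundamental

variable {p q : ℝ → ℝ} {F₁ G₁ F₂ G₂ : ℝ → ℝ → ℝ} {lam : ℝ} {f g f' g' : ℝ → ℝ}

theorem wronskian (H : IsHillFundamental p q F₁ G₁ F₂ G₂) (lam x : ℝ) :
    F₁ lam x * G₂ lam x - G₁ lam x * F₂ lam x = 1 := by
  rw [(H.fst lam).wronskian_eq (H.snd lam) x 0, H.F₁_zero, H.G₁_zero, H.G₂_zero]
  ring

/-- Both solutions have the same Wronskians with the fundamental system at `c`, hence at `x`. These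
are two linear equations for the values at `x`, with determinant `1`, solved by Cramer's rule. -/
theorem unique (H : IsHillFundamental p q F₁ G₁ F₂ G₂) (h : IsHillPair p q lam f g)
    (h' : IsHillPair p q lam f' g') {c : ℝ} (hf : f c = f' c) (hg : g c = g' c) (x : ℝ) :
    f x = f' x ∧ g x = g' x := by
  have w1 := h.wronskian_eq (H.fst lam) x c
  have w2 := h.wronskian_eq (H.snd lam) x c
  have w1' := h'.wronskian_eq (H.fst lam) x c
  have w2' := h'.wronskian_eq (H.snd lam) x c
  rw [hf, hg, ← w1'] at w1
  rw [hf, hg, ← w2'] at w2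
  have w := H.wronskian lam x
  constructor
  · linear_combination (-F₂ lam x) * w1 + F₁ lam x * w2 - (f x - f' x) * w
  · linear_combination (-G₂ lam x) * w1 + G₁ lam x * w2 - (g x - g' x) * w

theorem eq_comb (H : IsHillFundamental p q F₁ G₁ F₂ G₂) (h : IsHillPair p q lam f g) (x : ℝ) :
    f x = f 0 * F₁ lam x + g 0 * F₂ lam x ∧ g x = f 0 * G₁ lam x + g 0 * G₂ lam x :=
  H.unique (c := 0) h ((H.fst lam).comb (H.snd lam) (f 0) (g 0))
    (by simp [H.F₁_zero, H.F₂_zero]) (by simp [H.G₁_zero, H.G₂_zero]) x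

/-- A nontrivial solution multiplied by `ρ` over one period determines the trace of the
monodromy matrix. -/
theorem floquet_trace (H : IsHillFundamental p q F₁ G₁ F₂ G₂) (h : IsHillPair p q lam f g)
    {T ρ : ℝ} (hf : f T = ρ * f 0) (hg : g T = ρ * g 0) (hne : f 0 ≠ 0 ∨ g 0 ≠ 0) :
    ρ ^ 2 - (F₁ lam T + G₂ lam T) * ρ + 1 = 0 := by
  obtain ⟨e1, e2⟩ := H.eq_comb h T
  rw [hf] at e1
  rw [hg] at e2
  have w := H.wronskian lam T
  rcases hne with hne | hne
  · refine (mul_eq_zero.1 (?_ : f 0 * _ = 0)).resolve_left hne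
    linear_combination (-f 0) * w + (ρ - G₂ lam T) * e1 + F₂ lam T * e2
  · refine (mul_eq_zero.1 (?_ : g 0 * _ = 0)).resolve_left hne
    linear_combination (-g 0) * w + G₁ lam T * e1 + (ρ - F₁ lam T) * e2

/-- When `lam ≤ q`, neither `F₁ ^ 2` nor `G₂ ^ 2` decreases to the right of `0`, so both functions
stay at least `1`. -/
theorem two_le_trace (H : IsHillFundamental p q F₁ G₁ F₂ G₂) (hp_pos : ∀ x, 0 < p x)
    (hq : ∀ x, lam ≤ q x) {T : ℝ} (hT : 0 ≤ T) : 2 ≤ F₁ lam T + G₂ lam T := by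
  have h1 : 1 ≤ F₁ lam T := one_le_of_one_le_sq (H.fst lam).continuous_fst (H.F₁_zero lam)
    (fun x hx => by
      have := ((H.fst lam).sq_le_sq hp_pos hq (s := 0) (by simp [H.G₁_zero]) hx).1
      rwa [H.F₁_zero, one_pow] at this) hT
  have h2 : 1 ≤ G₂ lam T := one_le_of_one_le_sq (H.snd lam).continuous_snd (H.G₂_zero lam)
    (fun x hx => by
      have := ((H.snd lam).sq_le_sq hp_pos hq (s := 0) (by simp [H.F₂_zero]) hx).2
      rwa [H.G₂_zero, one_pow] at this) hT
  linarith

theorem continuous_trace (H : IsHillFundamental p q F₁ G₁ F₂ G₂) (hp : Continuous p)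
    (hp_pos : ∀ x, 0 < p x) (hq : Continuous q) {T : ℝ} (hT : 0 < T) :
    Continuous fun lam => F₁ lam T + G₂ lam T := by
  refine continuous_iff_continuousAt.2 fun lam => ?_
  have c1 := (IsHillPair.continuousAt_uncurry hp hp_pos hq H.fst H.F₁_zero H.G₁_zero
    (z := (lam, T)) hT).1
  have c2 := (IsHillPair.continuousAt_uncurry hp hp_pos hq H.snd H.F₂_zero H.G₂_zero
    (z := (lam, T)) hT).2
  have c : ContinuousAt (fun l : ℝ => (l, T)) lam := by fun_prop
  exact (ContinuousAt.comp (f := fun l : ℝ => (l, T)) c1 c).add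
    (ContinuousAt.comp (f := fun l : ℝ => (l, T)) c2 c)

/-- Trace `2` of the monodromy matrix gives a periodic eigenvalue. -/
theorem mem_periodicEigenvalues (H : IsHillFundamental p q F₁ G₁ F₂ G₂) (hp_pos : ∀ x, 0 < p x)
    {T : ℝ} (hT : 0 < T) (hpT : p T = p 0) (htr : F₁ lam T + G₂ lam T = 2) :
    lam ∈ periodicEigenvalues p q T := by
  have w := H.wronskian lam T
  -- A fixed vector of the monodromy matrix. If `F₂ lam T = 0` the matrix is triangular with
  -- determinant `1` and trace `2`, so both diagonal entries are `1`.
  obtain ⟨a, b, hab, e1, e2⟩ : ∃ a b : ℝ, (a ≠ 0 ∨ b ≠ 0) ∧ a * F₁ lam T + b * F₂ lam T = a ∧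
      a * G₁ lam T + b * G₂ lam T = b := by
    by_cases hF : F₂ lam T = 0
    · refine ⟨0, 1, Or.inr one_ne_zero, by simp [hF], ?_⟩
      rw [hF] at w
      have hsq : (G₂ lam T - 1) ^ 2 = 0 := by
        linear_combination G₂ lam T * htr - w
      have := pow_eq_zero_iff (two_ne_zero) |>.1 hsq
      linarith
    · refine ⟨F₂ lam T, 1 - F₁ lam T, Or.inl hF, by ring, ?_⟩
      linear_combination htr - w
  have h := (H.fst lam).comb (H.snd lam) a b
  set f := fun x => a * F₁ lam x + b * F₂ lam x with hf
  set g := fun x => a * G₁ lam x + b * G₂ lam x with hg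
  have hf0 : f 0 = a := by simp [hf, H.F₁_zero, H.F₂_zero]
  have hg0 : g 0 = b := by simp [hg, H.G₁_zero, H.G₂_zero]
  have hfT : f T = a := e1
  have hgT : g T = b := e2
  have hU := uniqueDiffOn_Icc hT
  have hd : ∀ x ∈ Icc 0 T, derivWithin f (Icc 0 T) x = g x / p x := fun x hx =>
    (h.hasDerivAt_fst x).hasDerivWithinAt.derivWithin (hU x hx)
  have hquasi : EqOn (fun y => p y * derivWithin f (Icc 0 T) y) g (Icc 0 T) := fun x hx => by
    simp only
    rw [hd x hx, mul_div_cancel₀ _ (hp_pos x).ne']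
  have h0 : (0 : ℝ) ∈ Icc 0 T := left_mem_Icc.2 hT.le
  have hTm : T ∈ Icc 0 T := right_mem_Icc.2 hT.le
  refine ⟨f, ⟨⟨fun x _ => (h.hasDerivAt_fst x).differentiableAt.differentiableWithinAt, ?_, ?_⟩,
    ?_, by rw [hf0, hfT], by rw [hd 0 h0, hd T hTm, hg0, hgT, hpT]⟩⟩
  · exact DifferentiableOn.congr
      (fun x _ => (h.hasDerivAt_snd x).differentiableAt.differentiableWithinAt) hquasi
  · intro x hx
    rw [derivWithin_congr hquasi (hquasi hx),
      (h.hasDerivAt_snd x).hasDerivWithinAt.derivWithin (hU x hx)]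
    ring
  · by_contra! hzero
    have ha : a = 0 := by rw [← hf0]; exact hzero 0 h0
    have hder : derivWithin f (Icc 0 T) 0 = 0 := by
      rw [derivWithin_congr (f := fun _ => 0) (fun x hx => hzero x hx) (hzero 0 h0)]
      simp
    rw [hd 0 h0, hg0, div_eq_zero_iff] at hder
    rcases hab with hab | hab
    · exact hab ha
    · exact hder.elim hab (hp_pos 0).ne'

/-- An eigenfunction on `[0, T]` is the restriction of a nontrivial periodic solution. -/
theorem exists_extension (H : IsHillFundamental p q F₁ G₁ F₂ G₂) (hp_pos : ∀ x, 0 < p x)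
    {T : ℝ} (hT : 0 < T) (hp_per : Function.Periodic p T) (hq_per : Function.Periodic q T)
    {f₀ : ℝ → ℝ} (hf₀ : IsPeriodicEigenfunction p q T lam f₀) :
    ∃ h k : ℝ → ℝ, IsHillPair p q lam h k ∧ EqOn f₀ h (Icc 0 T) ∧ Function.Periodic h T ∧
      Function.Periodic k T ∧ ∀ x, h x ≠ 0 ∨ k x ≠ 0 := by
  obtain ⟨⟨d1, d2, heq⟩, hne, hb, hb'⟩ := hf₀
  set g₀ := fun y => p y * derivWithin f₀ (Icc 0 T) y with hg₀
  have D1 : ∀ x ∈ Icc 0 T, HasDerivWithinAt f₀ (g₀ x / p x) (Icc 0 T) x := fun x hx => by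
    rw [hg₀, mul_div_cancel_left₀ _ (hp_pos x).ne']
    exact (d1 x hx).hasDerivWithinAt
  have D2 : ∀ x ∈ Icc 0 T, HasDerivWithinAt g₀ ((q x - lam) * f₀ x) (Icc 0 T) x := fun x hx => by
    refine HasDerivWithinAt.congr_deriv (d2 x hx).hasDerivWithinAt ?_
    change derivWithin g₀ (Icc 0 T) x = _
    linarith [heq x hx]
  -- The eigenfunction is known only on `[0, T]`, so constancy of its Wronskian is derived from
  -- right derivatives. Cramer's rule then identifies it with a global solution.
  have W : ∀ {f g : ℝ → ℝ}, IsHillPair p q lam f g → ∀ x ∈ Icc 0 T,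
      f₀ x * g x - g₀ x * f x = f₀ 0 * g 0 - g₀ 0 * f 0 := by
    intro f g hfg
    refine constant_of_has_deriv_right_zero ?_ fun x hx => ?_
    · exact (d1.continuousOn.mul hfg.continuous_snd.continuousOn).sub
        (d2.continuousOn.mul hfg.continuous_fst.continuousOn)
    · have hx' := Ico_subset_Icc_self hx
      have := (((D1 x hx').mul (hfg.hasDerivAt_snd x).hasDerivWithinAt).sub
        ((D2 x hx').mul (hfg.hasDerivAt_fst x).hasDerivWithinAt)).mono_of_mem_nhdsWithin
        (Icc_mem_nhdsGE_of_mem hx)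
      refine HasDerivWithinAt.congr_deriv this ?_
      ring
  have hpair := (H.fst lam).comb (H.snd lam) (f₀ 0) (g₀ 0)
  set h := fun x => f₀ 0 * F₁ lam x + g₀ 0 * F₂ lam x with hh
  set k := fun x => f₀ 0 * G₁ lam x + g₀ 0 * G₂ lam x with hk
  have h00 : h 0 = f₀ 0 := by simp [hh, H.F₁_zero, H.F₂_zero]
  have k00 : k 0 = g₀ 0 := by simp [hk, H.G₁_zero, H.G₂_zero]
  have E : ∀ x ∈ Icc 0 T, f₀ x = h x ∧ g₀ x = k x := fun x hx => by
    have w1 := W (H.fst lam) x hx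
    have w2 := W (H.snd lam) x hx
    rw [H.F₁_zero, H.G₁_zero] at w1
    rw [H.F₂_zero, H.G₂_zero] at w2
    have w := H.wronskian lam x
    simp only [hh, hk]
    constructor
    · linear_combination (-F₂ lam x) * w1 + F₁ lam x * w2 - f₀ x * w
    · linear_combination (-G₂ lam x) * w1 + G₁ lam x * w2 - g₀ x * w
  have hTm : T ∈ Icc 0 T := right_mem_Icc.2 hT.le
  have hg0T : g₀ 0 = g₀ T := by
    simp only [hg₀]
    rw [hb', hp_per.eq]
  have per := fun x => H.unique (c := 0) (hpair.shift hp_per hq_per) hpair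
    (by rw [zero_add, ← (E T hTm).1, ← hb, h00]) (by rw [zero_add, ← (E T hTm).2, ← hg0T, k00]) x
  refine ⟨h, k, hpair, fun x hx => (E x hx).1, fun x => (per x).1, fun x => (per x).2, ?_⟩
  by_contra! hx
  obtain ⟨x, hx1, hx2⟩ := hx
  obtain ⟨y, hy, hy0⟩ := hne
  exact hy0 ((E y hy).1.trans (H.unique hpair .zero hx1 hx2 y).1)

end IsHillFundamental

/-! ### Absence of zeros at the lowest eigenvalue -/

/-- Positivity on `(c, d]` of solutions vanishing at `c` with positive derivative is stable under
perturbation of the spectral parameter. -/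
theorem IsHillPair.eventually_pos {p q : ℝ → ℝ} (hp_pos : ∀ x, 0 < p x)
    {φ ψ : ℝ → ℝ → ℝ} (h : ∀ lam, IsHillPair p q lam (φ lam) (ψ lam)) {c d lam₁ : ℝ}
    (hφ : ∀ x, c ≤ x → ContinuousAt (fun z : ℝ × ℝ => φ z.1 z.2) (lam₁, x))
    (hψ : ContinuousAt (fun z : ℝ × ℝ => ψ z.1 z.2) (lam₁, c))
    (hφc : ∀ lam, φ lam c = 0) (hψc : 0 < ψ lam₁ c) (hpos : ∀ x ∈ Ioc c d, 0 < φ lam₁ x) :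
    ∀ᶠ lam in 𝓝 lam₁, ∀ x ∈ Ioc c d, 0 < φ lam x := by
  have key : ∀ᶠ lam in 𝓝 lam₁, ∀ x ∈ Icc c d, c < x → 0 < φ lam x := by
    refine isCompact_Icc.eventually_forall_of_forall_eventually
      (P := fun lam x => c < x → 0 < φ lam x) fun y hy => ?_
    rcases hy.1.eq_or_lt with rfl | hcy
    -- At the left endpoint `φ` vanishes, so continuity of `φ` cannot give positivity. Instead `ψ`
    -- is positive on a ball, which for the product metric contains the whole segment from `(z.1,
    -- c)` to `z`, and `φ` increases along it.
    · obtain ⟨ε, hε, hball⟩ := Metric.eventually_nhds_iff_ball.1 (hψ.eventually_const_lt hψc)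
      refine Metric.eventually_nhds_iff_ball.2 ⟨ε, hε, fun z hz hcz => ?_⟩
      have hz' := hz
      rw [← ball_prod_same, mem_prod] at hz'
      have hmono : StrictMonoOn (φ z.1) (Icc c z.2) := by
        refine strictMonoOn_of_deriv_pos (convex_Icc _ _) (h z.1).continuous_fst.continuousOn
          fun y hy => ?_
        rw [interior_Icc] at hy
        rw [((h z.1).hasDerivAt_fst y).deriv]
        refine div_pos (hball (z.1, y) ?_) (hp_pos y)
        rw [← ball_prod_same]
        refine ⟨hz'.1, ?_⟩
        have := hz'.2
        rw [Metric.mem_ball, Real.dist_eq, abs_lt] at this ⊢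
        constructor <;> linarith [hy.1, hy.2, this.2]
      have := hmono (left_mem_Icc.2 hcz.le) (right_mem_Icc.2 hcz.le) hcz
      rwa [hφc] at this
    · have := (hφ y hy.1).eventually_const_lt (hpos y ⟨hcy, hy.2⟩)
      exact this.mono fun z hz _ => hz
  exact key.mono fun lam hl x hx => hl x ⟨hx.1.le, hx.2⟩ hx.1

/-- A function vanishing at `d` and nonnegative to the left of `d` has nonpositive derivative. -/
theorem HasDerivAt.nonpos_of_nonneg_left {f : ℝ → ℝ} {f' c d : ℝ} (hf : HasDerivAt f f' d)
    (hcd : c < d) (hfd : f d = 0) (h : ∀ x ∈ Ioo c d, 0 ≤ f x) : f' ≤ 0 := by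
  have ht := (hasDerivWithinAt_iff_tendsto_slope' self_notMem_Iio).1
    (hf.hasDerivWithinAt (s := Iio d))
  refine le_of_tendsto ht ?_
  filter_upwards [Ioo_mem_nhdsLT hcd] with x hx
  rw [slope_def_field, hfd, sub_zero]
  exact div_nonpos_of_nonneg_of_nonpos (h x hx) (sub_nonpos.2 hx.2.le)

namespace IsHillFundamental

variable {p q : ℝ → ℝ} {F₁ G₁ F₂ G₂ : ℝ → ℝ → ℝ}

theorem ne_zero_or_ne_zero (H : IsHillFundamental p q F₁ G₁ F₂ G₂) {lam : ℝ} {f g : ℝ → ℝ}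
    (h : IsHillPair p q lam f g) {c : ℝ} (hc : g c ≠ 0) (x : ℝ) : f x ≠ 0 ∨ g x ≠ 0 := by
  by_contra! hx
  exact hc (H.unique h .zero hx.1 hx.2 c).2

/-- If a periodic solution vanishes somewhere, then the monodromy matrix has negative trace for some
smaller value of the spectral parameter. -/
theorem exists_trace_neg (H : IsHillFundamental p q F₁ G₁ F₂ G₂) (hp : Continuous p)
    (hp_pos : ∀ x, 0 < p x) (hq : Continuous q) {T : ℝ} (hT : 0 < T)
    (hp_per : Function.Periodic p T) (hq_per : Function.Periodic q T) {lam₀ m : ℝ} {h k : ℝ → ℝ}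
    (hk : IsHillPair p q lam₀ h k) (h_per : Function.Periodic h T)
    {c : ℝ} (hc : 0 < c) (hhc : h c = 0) (hkc : k c ≠ 0)
    (hm : ∀ x, m ≤ q x) (hm₀ : m ≤ lam₀) :
    ∃ lam ∈ Icc m lam₀, F₁ lam T + G₂ lam T < 0 := by
  set φ : ℝ → ℝ → ℝ := fun lam x => -F₂ lam c * F₁ lam x + F₁ lam c * F₂ lam x with hφ
  set ψ : ℝ → ℝ → ℝ := fun lam x => -F₂ lam c * G₁ lam x + F₁ lam c * G₂ lam x with hψ
  have P : ∀ lam, IsHillPair p q lam (φ lam) (ψ lam) := fun lam =>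
    (H.fst lam).comb (H.snd lam) _ _
  have φc : ∀ lam, φ lam c = 0 := fun lam => by simp only [hφ]; ring
  have ψc : ∀ lam, ψ lam c = 1 := fun lam => by
    simp only [hψ]; linear_combination H.wronskian lam c
  have C1 := fun (lam : ℝ) {x : ℝ} (hx : 0 < x) => IsHillPair.continuousAt_uncurry hp hp_pos hq
    H.fst H.F₁_zero H.G₁_zero (z := (lam, x)) hx
  have C2 := fun (lam : ℝ) {x : ℝ} (hx : 0 < x) => IsHillPair.continuousAt_uncurry hp hp_pos hq
    H.snd H.F₂_zero H.G₂_zero (z := (lam, x)) hx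
  have cc : ∀ lam x : ℝ, ContinuousAt (fun z : ℝ × ℝ => (z.1, c)) (lam, x) := fun lam x => by
    fun_prop
  have B1 : ∀ lam x : ℝ, ContinuousAt (fun z : ℝ × ℝ => F₁ z.1 c) (lam, x) := fun lam x =>
    ContinuousAt.comp (f := fun z : ℝ × ℝ => (z.1, c)) (g := fun z : ℝ × ℝ => F₁ z.1 z.2)
      (C1 lam hc).1 (cc lam x)
  have B2 : ∀ lam x : ℝ, ContinuousAt (fun z : ℝ × ℝ => F₂ z.1 c) (lam, x) := fun lam x =>
    ContinuousAt.comp (f := fun z : ℝ × ℝ => (z.1, c)) (g := fun z : ℝ × ℝ => F₂ z.1 z.2)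
      (C2 lam hc).1 (cc lam x)
  have cφ : ∀ lam x, c ≤ x → ContinuousAt (fun z : ℝ × ℝ => φ z.1 z.2) (lam, x) :=
    fun lam x hx => ((B2 lam x).neg.mul (C1 lam (hc.trans_le hx)).1).add
      ((B1 lam x).mul (C2 lam (hc.trans_le hx)).1)
  have cψ : ∀ lam, ContinuousAt (fun z : ℝ × ℝ => ψ z.1 z.2) (lam, c) :=
    fun lam => ((B2 lam c).neg.mul (C1 lam hc).2).add ((B1 lam c).mul (C2 lam hc).2)
  have hcT : c < c + T := lt_add_of_pos_right _ hT
  set S := {lam | lam ∈ Icc m lam₀ ∧ ∀ x ∈ Ioc c (c + T), 0 < φ lam x} with hS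
  have hmS : m ∈ S := by
    -- For `lam = m ≤ q` the quasi-derivative stays at least `1`, so `φ` increases from its zero at
    -- `c`.
    refine ⟨left_mem_Icc.2 hm₀, fun x hx => ?_⟩
    have hψ1 : ∀ y, c ≤ y → 1 ≤ ψ m y := fun y hy =>
      one_le_of_one_le_sq (P m).continuous_snd (ψc m) (fun t ht => by
        have := ((P m).sq_le_sq hp_pos hm (s := c) (by simp [φc]) ht).2
        rwa [ψc, one_pow] at this) hy
    have hmono : StrictMonoOn (φ m) (Ici c) := by
      refine strictMonoOn_of_deriv_pos (convex_Ici c) (P m).continuous_fst.continuousOn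
        fun y hy => ?_
      rw [interior_Ici] at hy
      rw [((P m).hasDerivAt_fst y).deriv]
      exact div_pos (one_pos.trans_le (hψ1 y (le_of_lt hy))) (hp_pos y)
    have := hmono self_mem_Ici (show x ∈ Ici c from hx.1.le) hx.1
    rwa [φc] at this
  have hSb : BddAbove S := ⟨lam₀, fun lam hl => hl.1.2⟩
  set lam₁ := sSup S with hlam₁
  have hcl : lam₁ ∈ closure S := csSup_mem_closure ⟨m, hmS⟩ hSb
  have hI : lam₁ ∈ Icc m lam₀ := closure_minimal (fun lam hl => hl.1) isClosed_Icc hcl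
  have hnn : ∀ x ∈ Ioc c (c + T), 0 ≤ φ lam₁ x := fun x hx => by
    have hcont : Continuous fun lam => φ lam x := continuous_iff_continuousAt.2 fun lam =>
      ContinuousAt.comp (f := fun l : ℝ => (l, x)) (cφ lam x hx.1.le) (by fun_prop)
    exact closure_minimal (t := {lam | 0 ≤ φ lam x}) (fun lam hl => (hl.2 x hx).le)
      (isClosed_le continuous_const hcont) hcl
  -- Otherwise `φ lam₁` is positive on all of `(c, c + T]`, and by stability `S` would extend beyond
  -- its supremum.
  have hzero : φ lam₁ (c + T) = 0 := by
    by_contra hne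
    have hposT : 0 < φ lam₁ (c + T) := lt_of_le_of_ne (hnn _ ⟨hcT, le_rfl⟩) (Ne.symm hne)
    have hpos : ∀ x ∈ Ioc c (c + T), 0 < φ lam₁ x := fun x hx => by
      refine lt_of_le_of_ne (hnn x hx) fun h0 => ?_
      rcases hx.2.eq_or_lt with rfl | hxT
      · exact hne h0.symm
      · have hmin : IsLocalMin (φ lam₁) x := by
          filter_upwards [Ioo_mem_nhds hx.1 hxT] with y hy
          rw [← h0]
          exact hnn y (Ioo_subset_Ioc_self hy)
        -- An interior zero of a nonnegative solution is a double zero, which forces the solution to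
        -- be trivial.
        have hd := hmin.hasDerivAt_eq_zero ((P lam₁).hasDerivAt_fst x)
        have hψ0 : ψ lam₁ x = 0 := (div_eq_zero_iff.1 hd).resolve_right (hp_pos x).ne'
        exact (H.ne_zero_or_ne_zero (P lam₁) (c := c) (by simp [ψc]) x).elim
          (fun h => h h0.symm) (fun h => h hψ0)
    -- At `lam₀` one has `h = k c * φ`, and `h` vanishes at `c + T` by periodicity.
    have hne₀ : lam₁ ≠ lam₀ := fun heq => by
      have hu := H.unique ((P lam₀).comb (P lam₀) (k c) 0) hk (c := c) (by simp [φc, hhc])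
        (by simp [ψc]) (c + T)
      have hz := hu.1
      rw [h_per c, hhc, zero_mul, add_zero] at hz
      exact (heq ▸ hne) ((mul_eq_zero.1 hz).resolve_left hkc)
    have hlt : lam₁ < lam₀ := lt_of_le_of_ne hI.2 hne₀
    have hev := IsHillPair.eventually_pos hp_pos P (cφ lam₁) (cψ lam₁) φc
      (by simp [ψc]) hpos
    obtain ⟨lam, hl, hl'⟩ := ((hev.filter_mono nhdsWithin_le_nhds).and
      (Ioc_mem_nhdsGT hlt)).exists
    exact absurd (le_csSup hSb ⟨⟨hI.1.trans hl'.1.le, hl'.2⟩, hl⟩) (not_le.2 hl'.1)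
  have hne := H.ne_zero_or_ne_zero (P lam₁) (c := c) (by simp [ψc])
  have hρ : ψ lam₁ (c + T) < 0 := by
    refine lt_of_le_of_ne ?_ ((hne (c + T)).resolve_left (not_not.2 hzero))
    have := ((P lam₁).hasDerivAt_fst (c + T)).nonpos_of_nonneg_left hcT hzero
      fun x hx => hnn x (Ioo_subset_Ioc_self hx)
    by_contra! hpos
    exact absurd (div_pos hpos (hp_pos _)) (not_lt.2 this)
  -- The translate by `T` and the multiple by `ρ = ψ lam₁ (c + T)` have the same data at `c`, so `ρ`
  -- is a Floquet multiplier.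
  have hper := H.unique ((P lam₁).shift hp_per hq_per)
    ((P lam₁).comb (P lam₁) (ψ lam₁ (c + T)) 0) (c := c) (by simp [φc, hzero]) (by simp [ψc]) 0
  simp only [zero_add, zero_mul, add_zero] at hper
  have htr := H.floquet_trace (P lam₁) hper.1 hper.2 (hne 0)
  refine ⟨lam₁, hI, ?_⟩
  by_contra! hge
  nlinarith [mul_nonneg hge (neg_nonneg.2 hρ.le), sq_nonneg (ψ lam₁ (c + T))]

/-- Periodic solutions at the lowest periodic eigenvalue have no zeros. -/
theorem ne_zero_of_isLeast (H : IsHillFundamental p q F₁ G₁ F₂ G₂) (hp : Continuous p)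
    (hp_pos : ∀ x, 0 < p x) (hq : Continuous q) {T : ℝ} (hT : 0 < T)
    (hp_per : Function.Periodic p T) (hq_per : Function.Periodic q T) {lam₀ : ℝ}
    (hleast : IsLeast (periodicEigenvalues p q T) lam₀) {h k : ℝ → ℝ}
    (hk : IsHillPair p q lam₀ h k) (h_per : Function.Periodic h T)
    (hne : ∀ x, h x ≠ 0 ∨ k x ≠ 0) (x : ℝ) : h x ≠ 0 := by
  intro hx
  -- The zero is moved into `(0, T]` because joint continuity in parameter and point was established
  -- only at positive points.
  obtain ⟨c, hc, hxc⟩ := h_per.exists_mem_Ioc hT x 0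
  have hhc : h c = 0 := hxc ▸ hx
  obtain ⟨m₁, hm₁⟩ := (hq_per.compact_of_continuous hT.ne' hq).bddBelow
  have hm : ∀ x, min m₁ lam₀ ≤ q x := fun x => (min_le_left _ _).trans (hm₁ (mem_range_self x))
  obtain ⟨lam₁, hI, hneg⟩ := H.exists_trace_neg hp hp_pos hq hT hp_per hq_per hk h_per hc.1 hhc
    ((hne c).resolve_left (not_not.2 hhc)) hm (min_le_right _ _)
  have hcont := H.continuous_trace hp hp_pos hq hT
  obtain ⟨lam, hl, htr⟩ := intermediate_value_Icc' hI.1 hcont.continuousOn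
    ⟨(hneg.trans two_pos).le, H.two_le_trace hp_pos hm hT.le⟩
  have hmem := H.mem_periodicEigenvalues hp_pos hT hp_per.eq htr
  have heq : lam = lam₁ := le_antisymm hl.2 (hI.2.trans (hleast.2 hmem))
  subst heq
  simp only at htr
  linarith

end IsHillFundamental

/-! ### Iterated integrals and their power series -/

/-- Iterated integrals with weight `α` at the odd steps and `β` at the even steps. -/
noncomputable def alternatingIntegral (α β : ℝ → ℝ) : ℕ → ℝ → ℝ
  | 0 => fun _ => 1
  | n + 1 => fun x =>
      ∫ ξ in (0 : ℝ)..x, alternatingIntegral α β n ξ * (if Odd (n + 1) then α ξ else β ξ)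

section AlternatingIntegral

variable {α β : ℝ → ℝ}

theorem continuous_alternatingIntegral (hα : Continuous α) (hβ : Continuous β) (n : ℕ) :
    Continuous (alternatingIntegral α β n) := by
  induction n with
  | zero => exact continuous_const
  | succ n ih =>
    refine intervalIntegral.continuous_primitive (fun a b => Continuous.intervalIntegrable ?_ a b) 0
    split_ifs
    · exact ih.mul hα
    · exact ih.mul hβ

theorem alternatingIntegral_odd (n : ℕ) (x : ℝ) : alternatingIntegral α β (2 * n + 1) x =
    ∫ ξ in (0 : ℝ)..x, alternatingIntegral α β (2 * n) ξ * α ξ := by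
  have h : Odd (2 * n + 1) := ⟨n, rfl⟩
  simp [alternatingIntegral, h]

theorem alternatingIntegral_even (n : ℕ) (x : ℝ) : alternatingIntegral α β (2 * (n + 1)) x =
    ∫ ξ in (0 : ℝ)..x, alternatingIntegral α β (2 * n + 1) ξ * β ξ := by
  have h : ¬ Odd (2 * n + 1 + 1) := by grind
  simp [show 2 * (n + 1) = 2 * n + 1 + 1 by ring, alternatingIntegral, h]

/-- Inductive step of the factorial estimates: integrating the bound for `k` against the constant
`C` gives exactly the bound for `k + 1`. -/
theorem abs_integral_mul_le {w γ : ℝ → ℝ} {M C T : ℝ} {k : ℕ}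
    (hw : ∀ x ∈ Icc 0 T, |w x| ≤ M * ((C * x) ^ k / k.factorial))
    (hγ : ∀ x ∈ Icc 0 T, |γ x| ≤ C) {x : ℝ} (hx : x ∈ Icc 0 T) :
    |∫ ξ in (0 : ℝ)..x, w ξ * γ ξ| ≤ M * ((C * x) ^ (k + 1) / (k + 1).factorial) := by
  have hcont : Continuous fun ξ : ℝ => M * ((C * ξ) ^ k / k.factorial) * C := by fun_prop
  refine (intervalIntegral.norm_integral_le_of_norm_le hx.1 (f := fun ξ => w ξ * γ ξ)
    (μ := MeasureTheory.volume)
    (g := fun ξ => M * ((C * ξ) ^ k / k.factorial) * C) (.of_forall fun ξ hξ => ?_)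
    (hcont.intervalIntegrable _ _)).trans (le_of_eq ?_)
  · have hξ' : ξ ∈ Icc 0 T := ⟨hξ.1.le, hξ.2.trans hx.2⟩
    rw [Real.norm_eq_abs, abs_mul]
    exact mul_le_mul (hw ξ hξ') (hγ ξ hξ') (abs_nonneg _) ((abs_nonneg _).trans (hw ξ hξ'))
  · have hd : ∀ ξ ∈ uIcc 0 x, HasDerivAt
        (fun ξ : ℝ => M * ((C * ξ) ^ (k + 1) / (k + 1).factorial))
        (M * ((C * ξ) ^ k / k.factorial) * C) ξ := fun ξ _ => by
      have := ((((hasDerivAt_id ξ).const_mul C).pow (k + 1)).div_const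
        ((k + 1).factorial : ℝ)).const_mul M
      refine HasDerivAt.congr_deriv this ?_
      rw [Nat.factorial_succ]
      push_cast
      have : (k.factorial : ℝ) ≠ 0 := by positivity
      simp only [id]
      field_simp
    rw [intervalIntegral.integral_eq_sub_of_hasDerivAt hd (hcont.intervalIntegrable _ _)]
    simp

theorem abs_alternatingIntegral_le {C T : ℝ} (hα : ∀ x ∈ Icc 0 T, |α x| ≤ C)
    (hβ : ∀ x ∈ Icc 0 T, |β x| ≤ C) (n : ℕ) :
    ∀ x ∈ Icc 0 T, |alternatingIntegral α β n x| ≤ (C * x) ^ n / n.factorial := by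
  induction n with
  | zero => intro x _; simp [alternatingIntegral]
  | succ n ih =>
    intro x hx
    have := abs_integral_mul_le (M := 1) (γ := fun ξ => if Odd (n + 1) then α ξ else β ξ)
      (by simpa using ih) (fun x hx => by
        split_ifs
        · exact hα x hx
        · exact hβ x hx) hx
    simpa [alternatingIntegral] using this

variable {u z : ℝ → ℝ} {μ : ℝ}

/-- Written as integral equations, the system turns each remainder into the next: integrate against
`μ α`, then against `β`. After `n` rounds only a `2n`-fold iterated integral of `u` is left, and `M`
bounds `u`. -/
theorem abs_remainder_le (hα : Continuous α) (hβ : Continuous β)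
    (hu : ∀ t, HasDerivAt u (β t * z t) t) (hz : ∀ t, HasDerivAt z (μ * (α t * u t)) t)
    (hu0 : u 0 = 1) (hz0 : z 0 = 0) {C M T : ℝ} (hαC : ∀ x ∈ Icc 0 T, |α x| ≤ C)
    (hβC : ∀ x ∈ Icc 0 T, |β x| ≤ C) (hM : ∀ x ∈ Icc 0 T, |u x| ≤ M) (n : ℕ) :
    ∀ x ∈ Icc 0 T, |u x - ∑ k ∈ Finset.range n, μ ^ k * alternatingIntegral α β (2 * k) x| ≤
      M * |μ| ^ n * ((C * x) ^ (2 * n) / (2 * n).factorial) := by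
  have cu : Continuous u := continuous_iff_continuousAt.2 fun t => (hu t).continuousAt
  have cz : Continuous z := continuous_iff_continuousAt.2 fun t => (hz t).continuousAt
  have cJ := continuous_alternatingIntegral hα hβ
  have czβ : ∀ a b, IntervalIntegrable (fun ξ => z ξ * β ξ) MeasureTheory.volume a b :=
    (cz.mul hβ).intervalIntegrable
  have cuα : ∀ a b, IntervalIntegrable (fun ξ => u ξ * α ξ) MeasureTheory.volume a b :=
    (cu.mul hα).intervalIntegrable
  have cJα : ∀ c k a b, IntervalIntegrable (fun ξ => c * alternatingIntegral α β k ξ * α ξ)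
      MeasureTheory.volume a b := fun c k =>
    ((continuous_const.mul (cJ k)).mul hα).intervalIntegrable
  have cJβ : ∀ c k a b, IntervalIntegrable (fun ξ => c * alternatingIntegral α β k ξ * β ξ)
      MeasureTheory.volume a b := fun c k =>
    ((continuous_const.mul (cJ k)).mul hβ).intervalIntegrable
  have iu : ∀ x, u x = 1 + ∫ ξ in (0 : ℝ)..x, z ξ * β ξ := fun x => by
    rw [intervalIntegral.integral_eq_sub_of_hasDerivAt (f := u)
      (fun t _ => by simpa only [mul_comm] using hu t)
      (czβ _ _), hu0]
    ring
  have iz : ∀ x, z x = ∫ ξ in (0 : ℝ)..x, μ * (u ξ * α ξ) := fun x => by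
    rw [intervalIntegral.integral_eq_sub_of_hasDerivAt (f := z)
      (fun t _ => by simpa only [mul_comm (u t)] using hz t)
      ((cuα _ _).const_mul μ), hz0]
    ring
  induction n with
  | zero => intro x hx; simpa using hM x hx
  | succ n ih =>
    have hS : ∀ x ∈ Icc 0 T, |z x - ∑ k ∈ Finset.range n,
        μ ^ (k + 1) * alternatingIntegral α β (2 * k + 1) x| ≤
        M * |μ| ^ (n + 1) * ((C * x) ^ (2 * n + 1) / (2 * n + 1).factorial) := fun x hx => by
      have e : z x - ∑ k ∈ Finset.range n, μ ^ (k + 1) * alternatingIntegral α β (2 * k + 1) x =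
          μ * ∫ ξ in (0 : ℝ)..x,
            (u ξ - ∑ k ∈ Finset.range n, μ ^ k * alternatingIntegral α β (2 * k) ξ) * α ξ := by
        simp_rw [sub_mul, Finset.sum_mul]
        rw [intervalIntegral.integral_sub (cuα _ _)
          (by simpa only [Finset.sum_fn] using
            IntervalIntegrable.sum (Finset.range n) fun k _ => cJα _ _ _ _),
          intervalIntegral.integral_finsetSum fun k _ => cJα _ _ _ _,
          mul_sub, ← intervalIntegral.integral_const_mul, ← iz, Finset.mul_sum]
        congr 1
        refine Finset.sum_congr rfl fun k _ => ?_
        simp_rw [mul_assoc (μ ^ k)]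
        rw [intervalIntegral.integral_const_mul, alternatingIntegral_odd]
        ring
      rw [e, abs_mul]
      calc _ ≤ |μ| * (M * |μ| ^ n * ((C * x) ^ (2 * n + 1) / (2 * n + 1).factorial)) :=
            mul_le_mul_of_nonneg_left (abs_integral_mul_le ih hαC hx) (abs_nonneg _)
        _ = _ := by ring
    intro x hx
    have e : u x - ∑ k ∈ Finset.range (n + 1), μ ^ k * alternatingIntegral α β (2 * k) x =
        ∫ ξ in (0 : ℝ)..x, (z ξ - ∑ k ∈ Finset.range n,
          μ ^ (k + 1) * alternatingIntegral α β (2 * k + 1) ξ) * β ξ := by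
      simp_rw [sub_mul, Finset.sum_mul]
      rw [intervalIntegral.integral_sub (czβ _ _)
        (by simpa only [Finset.sum_fn] using
            IntervalIntegrable.sum (Finset.range n) fun k _ => cJβ _ _ _ _),
          intervalIntegral.integral_finsetSum fun k _ => cJβ _ _ _ _,
        Finset.sum_range_succ', iu x]
      simp_rw [mul_assoc (μ ^ (_ + 1)), intervalIntegral.integral_const_mul,
        ← alternatingIntegral_even]
      simp only [pow_zero, alternatingIntegral, mul_one]
      ring
    rw [e]
    exact abs_integral_mul_le hS hβC hx

theorem summable_even_bound (A R : ℝ) :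
    Summable fun n : ℕ => A ^ (2 * n) / (2 * n).factorial * R ^ n := by
  -- Since `n! ≤ (2n)!`, the exponential series of `A ^ 2 * |R|` dominates.
  refine Summable.of_norm_bounded (Real.summable_pow_div_factorial (A ^ 2 * |R|)) fun n => ?_
  rw [norm_mul, norm_div, norm_pow, norm_pow, mul_pow, pow_mul, div_mul_eq_mul_div]
  simp only [Real.norm_eq_abs, Nat.abs_cast, sq_abs]
  gcongr
  linarith

/-- The series of iterated integrals sums to the solution of the planar system. -/
theorem hasSum_alternatingIntegral (hα : Continuous α) (hβ : Continuous β)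
    (hu : ∀ t, HasDerivAt u (β t * z t) t) (hz : ∀ t, HasDerivAt z (μ * (α t * u t)) t)
    (hu0 : u 0 = 1) (hz0 : z 0 = 0) {C T : ℝ} (hT : 0 ≤ T) (hαC : ∀ x ∈ Icc 0 T, |α x| ≤ C)
    (hβC : ∀ x ∈ Icc 0 T, |β x| ≤ C) :
    HasSum (fun n => alternatingIntegral α β (2 * n) T * μ ^ n) (u T) := by
  have cu : Continuous u := continuous_iff_continuousAt.2 fun t => (hu t).continuousAt
  obtain ⟨M, hM⟩ := (isCompact_Icc (a := 0) (b := T)).exists_bound_of_continuousOn cu.continuousOn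
  have hTm : T ∈ Icc 0 T := right_mem_Icc.2 hT
  have hs : Summable fun n => alternatingIntegral α β (2 * n) T * μ ^ n := by
    refine Summable.of_norm_bounded (summable_even_bound (C * T) |μ|) fun n => ?_
    rw [norm_mul, norm_pow, Real.norm_eq_abs, Real.norm_eq_abs]
    gcongr
    exact abs_alternatingIntegral_le hαC hβC _ T hTm
  refine (hasSum_iff_tendsto_nat_of_summable_norm hs.norm).2 ?_
  have h0 : Tendsto (fun n : ℕ => M * ((C * T) ^ (2 * n) / (2 * n).factorial * |μ| ^ n)) atTop
      (𝓝 0) := by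
    simpa using (summable_even_bound (C * T) |μ|).tendsto_atTop_zero.const_mul M
  have hR : Tendsto (fun n => u T - ∑ k ∈ Finset.range n,
      alternatingIntegral α β (2 * k) T * μ ^ k) atTop (𝓝 0) := by
    refine squeeze_zero_norm (fun n => ?_) h0
    have := abs_remainder_le hα hβ hu hz hu0 hz0 hαC hβC hM n T hTm
    simp_rw [mul_comm (alternatingIntegral α β _ T)]
    refine this.trans (le_of_eq (by ring))
  simpa using hR.const_sub (u T)

end AlternatingIntegral

/-! ### The discriminant as a sum of two series -/

/-- The minus signs are absorbed into the weight. On `[0, T]` the integrals see `f₀` only there, so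
it can be replaced by its smooth periodic extension `h`. -/
theorem sppsXTilde_eq_alternatingIntegral {p f₀ h : ℝ → ℝ} {T : ℝ} (hf : EqOn f₀ h (Icc 0 T))
    (n : ℕ) : ∀ x ∈ Icc 0 T, sppsXTilde p f₀ n x =
      alternatingIntegral (fun ξ => h ξ ^ 2) (fun ξ => -(1 / (p ξ * h ξ ^ 2))) n x := by
  induction n with
  | zero => intro x _; rfl
  | succ n ih =>
    intro x hx
    have hsub : uIcc 0 x ⊆ Icc 0 T := by
      rw [uIcc_of_le hx.1]
      exact Icc_subset_Icc_right hx.2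
    simp only [sppsXTilde, alternatingIntegral]
    split_ifs
    · refine intervalIntegral.integral_congr fun ξ hξ => ?_
      simp only [ih ξ (hsub hξ), hf (hsub hξ)]
    · rw [← intervalIntegral.integral_neg]
      refine intervalIntegral.integral_congr fun ξ hξ => ?_
      simp only [ih ξ (hsub hξ), hf (hsub hξ), mul_neg]

theorem sppsX_eq_alternatingIntegral {p f₀ h : ℝ → ℝ} {T : ℝ} (hf : EqOn f₀ h (Icc 0 T))
    (n : ℕ) : ∀ x ∈ Icc 0 T, sppsX p f₀ n x =
      alternatingIntegral (fun ξ => -(1 / (p ξ * h ξ ^ 2))) (fun ξ => h ξ ^ 2) n x := by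
  induction n with
  | zero => intro x _; rfl
  | succ n ih =>
    intro x hx
    have hsub : uIcc 0 x ⊆ Icc 0 T := by
      rw [uIcc_of_le hx.1]
      exact Icc_subset_Icc_right hx.2
    simp only [sppsX, alternatingIntegral]
    split_ifs
    · rw [← intervalIntegral.integral_neg]
      refine intervalIntegral.integral_congr fun ξ hξ => ?_
      simp only [ih ξ (hsub hξ), hf (hsub hξ), mul_neg]
    · refine intervalIntegral.integral_congr fun ξ hξ => ?_
      simp only [ih ξ (hsub hξ), hf (hsub hξ)]

namespace IsHillPair

variable {p q : ℝ → ℝ} {lam lam₀ : ℝ} {f g h k : ℝ → ℝ}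

theorem hasDerivAt_div (hf : IsHillPair p q lam f g) (hh : IsHillPair p q lam₀ h k)
    (hp : ∀ x, 0 < p x) (hne : ∀ x, h x ≠ 0) (t : ℝ) :
    HasDerivAt (fun x => f x / h x) ((h t * g t - k t * f t) / (p t * h t ^ 2)) t := by
  refine HasDerivAt.congr_deriv ((hf.hasDerivAt_fst t).div (hh.hasDerivAt_fst t) (hne t)) ?_
  have := hne t
  have := (hp t).ne'
  field_simp

theorem hasDerivAt_wronskian (hf : IsHillPair p q lam f g) (hh : IsHillPair p q lam₀ h k)
    (t : ℝ) :
    HasDerivAt (fun x => h x * g x - k x * f x) (-((lam - lam₀) * (h t * f t))) t := by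
  refine HasDerivAt.congr_deriv (((hh.hasDerivAt_fst t).mul (hf.hasDerivAt_snd t)).sub
    ((hh.hasDerivAt_snd t).mul (hf.hasDerivAt_fst t))) ?_
  ring

end IsHillPair

/-- The trace of the monodromy matrix as a power series centred at a value `lam₀` for which there is
a periodic solution without zeros. -/
theorem IsHillFundamental.hasSum_trace {p q : ℝ → ℝ} {F₁ G₁ F₂ G₂ : ℝ → ℝ → ℝ}
    (H : IsHillFundamental p q F₁ G₁ F₂ G₂) (hp : Continuous p) (hp_pos : ∀ x, 0 < p x)
    {T : ℝ} (hT : 0 ≤ T) {lam₀ : ℝ} {h k : ℝ → ℝ} (hh : IsHillPair p q lam₀ h k)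
    (h_per : Function.Periodic h T) (k_per : Function.Periodic k T) (hne : ∀ x, h x ≠ 0)
    {C : ℝ} (hC₁ : ∀ x ∈ Icc 0 T, |h x ^ 2| ≤ C)
    (hC₂ : ∀ x ∈ Icc 0 T, |-(1 / (p x * h x ^ 2))| ≤ C) (lam : ℝ) :
    HasSum (fun n =>
      (alternatingIntegral (fun ξ => h ξ ^ 2) (fun ξ => -(1 / (p ξ * h ξ ^ 2))) (2 * n) T +
        alternatingIntegral (fun ξ => -(1 / (p ξ * h ξ ^ 2))) (fun ξ => h ξ ^ 2) (2 * n) T) *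
        (lam - lam₀) ^ n) (F₁ lam T + G₂ lam T) := by
  have c₁ : Continuous fun ξ => h ξ ^ 2 := hh.continuous_fst.pow 2
  have c₂ : Continuous fun ξ => -(1 / (p ξ * h ξ ^ 2)) :=
    (continuous_const.div (hp.mul c₁) fun x => (mul_pos (hp_pos x)
      (pow_pos (abs_pos.2 (hne x)) 2 |>.trans_eq (sq_abs _))).ne').neg
  have P₁ := (H.fst lam).comb (H.snd lam) (h 0) (k 0)
  have P₂ := (H.fst lam).comb (H.snd lam) 0 (h 0)⁻¹
  -- `P₁` has the data of `h` at `0`, so the quotient starts at `1` and the Wronskian at `0`. At `T`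
  -- the quotient is `F₁ + (k 0 / h 0) F₂`.
  have s₁ := hasSum_alternatingIntegral c₁ c₂
    (u := fun x => (h 0 * F₁ lam x + k 0 * F₂ lam x) / h x)
    (z := fun x => -(h x * (h 0 * G₁ lam x + k 0 * G₂ lam x) -
      k x * (h 0 * F₁ lam x + k 0 * F₂ lam x))) (μ := lam - lam₀)
    (fun t => (P₁.hasDerivAt_div hh hp_pos hne t).congr_deriv (by ring))
    (fun t => (P₁.hasDerivAt_wronskian hh t).neg.congr_deriv (by
      have := hne t
      field_simp))
    (by simp [H.F₁_zero, H.F₂_zero, hne 0])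
    (by simp [H.F₁_zero, H.F₂_zero, H.G₁_zero, H.G₂_zero]; ring) hT hC₁ hC₂
  -- The roles are exchanged: `P₂` vanishes at `0` and is scaled so that its Wronskian with `h`
  -- starts at `1`. At `T` this Wronskian is `G₂ - (k 0 / h 0) F₂`, so the `F₂` terms cancel in the
  -- sum.
  have s₂ := hasSum_alternatingIntegral c₂ c₁
    (u := fun x => h x * (0 * G₁ lam x + (h 0)⁻¹ * G₂ lam x) -
      k x * (0 * F₁ lam x + (h 0)⁻¹ * F₂ lam x))
    (z := fun x => -(lam - lam₀) * ((0 * F₁ lam x + (h 0)⁻¹ * F₂ lam x) / h x))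
    (μ := lam - lam₀)
    (fun t => (P₂.hasDerivAt_wronskian hh t).congr_deriv (by
      have := hne t
      field_simp))
    (fun t => ((P₂.hasDerivAt_div hh hp_pos hne t).const_mul _).congr_deriv (by ring))
    (by simp [H.F₂_zero, H.G₂_zero, hne 0]) (by simp [H.F₂_zero]) hT hC₂ hC₁
  convert s₁.add s₂ using 1
  · funext n
    ring
  · have := hne 0
    rw [h_per.eq, k_per.eq]
    field_simp
    ring

/-- Even iterated integrals give power series converging uniformly on bounded sets. -/
theorem tendstoUniformlyOn_of_hasSum_alternatingIntegral {α β : ℝ → ℝ} {D : ℝ → ℝ}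
    {C T lam₀ : ℝ} (hT : 0 ≤ T) (hα : ∀ x ∈ Icc 0 T, |α x| ≤ C) (hβ : ∀ x ∈ Icc 0 T, |β x| ≤ C)
    (hD : ∀ lam, HasSum (fun n => (alternatingIntegral α β (2 * n) T +
      alternatingIntegral β α (2 * n) T) * (lam - lam₀) ^ n) (D lam))
    {K : Set ℝ} (hK : Bornology.IsBounded K) :
    TendstoUniformlyOn (fun (N : ℕ) (lam : ℝ) => ∑ n ∈ Finset.range N,
      (alternatingIntegral α β (2 * n) T + alternatingIntegral β α (2 * n) T) *
        (lam - lam₀) ^ n) D atTop K := by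
  obtain ⟨R, hR⟩ := hK.subset_closedBall lam₀
  have hTm : T ∈ Icc 0 T := right_mem_Icc.2 hT
  have hsum : D = fun lam => ∑' n : ℕ, (alternatingIntegral α β (2 * n) T +
      alternatingIntegral β α (2 * n) T) * (lam - lam₀) ^ n :=
    funext fun lam => (hD lam).tsum_eq.symm
  rw [hsum]
  -- Weierstrass M-test; the factor `2` accounts for the two families of integrals.
  refine tendstoUniformlyOn_tsum_nat ((summable_even_bound (C * T) R).mul_left 2)
    fun n lam hlam => ?_
  have hle : |lam - lam₀| ≤ R := by simpa [Real.dist_eq] using hR hlam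
  have h₁ := abs_alternatingIntegral_le hα hβ (2 * n) T hTm
  have h₂ := abs_alternatingIntegral_le hβ hα (2 * n) T hTm
  have h₃ : |alternatingIntegral α β (2 * n) T + alternatingIntegral β α (2 * n) T| ≤
      2 * ((C * T) ^ (2 * n) / (2 * n).factorial) := (abs_add_le _ _).trans (by linarith)
  rw [Real.norm_eq_abs, abs_mul, abs_pow, ← mul_assoc]
  exact mul_le_mul h₃ (pow_le_pow_left₀ (abs_nonneg _) hle n) (by positivity)
    ((abs_nonneg _).trans h₃)

theorem theorem1 (p q : ℝ → ℝ) (T : ℝ) (hT : 0 < T)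
    (hp : ContDiff ℝ 1 p) (hp_pos : ∀ x, 0 < p x) (hq : Continuous q)
    (hp_per : Function.Periodic p T) (hq_per : Function.Periodic q T)
    (lam₀ : ℝ) (hlam₀ : IsLeast (periodicEigenvalues p q T) lam₀)
    (f₀ : ℝ → ℝ) (hf₀ : IsPeriodicEigenfunction p q T lam₀ f₀) :
    (∀ x ∈ Set.Icc 0 T, f₀ x ≠ 0) ∧
    (∀ lam : ℝ, HasSum
      (fun n : ℕ => (sppsXTilde p f₀ (2 * n) T + sppsX p f₀ (2 * n) T) * (lam - lam₀) ^ n)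
      (hillDiscriminant p q T lam)) ∧
    (∀ K : Set ℝ, IsCompact K → TendstoUniformlyOn
      (fun (N : ℕ) (lam : ℝ) => ∑ n ∈ Finset.range N,
        (sppsXTilde p f₀ (2 * n) T + sppsX p f₀ (2 * n) T) * (lam - lam₀) ^ n)
      (hillDiscriminant p q T) Filter.atTop K) := by
  have hpc := hp.continuous
  obtain ⟨F₁, G₁, F₂, G₂, H, hD⟩ := exists_isHillFundamental hpc hp_pos hq hp_per.eq
  obtain ⟨h, k, hh, hEq, h_per, k_per, hnt⟩ := H.exists_extension hp_pos hT hp_per hq_per hf₀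
  have hne := H.ne_zero_of_isLeast hpc hp_pos hq hT hp_per hq_per hlam₀ hh h_per hnt
  have hTm : T ∈ Icc 0 T := right_mem_Icc.2 hT.le
  have c₁ : Continuous fun ξ => h ξ ^ 2 := hh.continuous_fst.pow 2
  have c₂ : Continuous fun ξ => -(1 / (p ξ * h ξ ^ 2)) :=
    (continuous_const.div (hpc.mul c₁) fun x =>
      mul_ne_zero (hp_pos x).ne' (pow_ne_zero 2 (hne x))).neg
  obtain ⟨C₁, hC₁⟩ := (isCompact_Icc (a := 0) (b := T)).exists_bound_of_continuousOn c₁.continuousOn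
  obtain ⟨C₂, hC₂⟩ := (isCompact_Icc (a := 0) (b := T)).exists_bound_of_continuousOn c₂.continuousOn
  have b₁ : ∀ x ∈ Icc 0 T, |h x ^ 2| ≤ max C₁ C₂ := fun x hx => (hC₁ x hx).trans (le_max_left _ _)
  have b₂ : ∀ x ∈ Icc 0 T, |-(1 / (p x * h x ^ 2))| ≤ max C₁ C₂ := fun x hx =>
    (hC₂ x hx).trans (le_max_right _ _)
  have hsum := H.hasSum_trace hpc hp_pos hT.le hh h_per k_per hne b₁ b₂
  simp_rw [← hD] at hsum
  simp_rw [fun n => sppsXTilde_eq_alternatingIntegral (p := p) hEq n T hTm,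
    fun n => sppsX_eq_alternatingIntegral (p := p) hEq n T hTm]
  exact ⟨fun x hx => by rw [hEq hx]; exact hne x, hsum, fun K hK =>
    tendstoUniformlyOn_of_hasSum_alternatingIntegral hT.le b₁ b₂ hsum hK.isBounded⟩
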